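/- A set of $n\ge 1$ independent tasks has to be executed by $m\ge 2$ identical processors. Time is divided into unit slots $t=0,1,2,\dots$; task $j$ has a processing time $p_j$ (a positive integer number of slots) that is unknown to the scheduler. Each processor has a queue; at time $0$ the tasks are spread arbitrarily among the queues. Decentralized list scheduling (DLS) works as follows. In each slot, a processor whose queue is not empty executes one unit of one task of its queue, without preemption; when a task is completed, it leaves the queue, and any other task of the queue is started in the next slot. A processor whose queue is empty at the beginning of the slot sends one steal request to a processor chosen uniformly at random among the $m-1$ others, independently of the other processors and of the past. The request fails if the target's queue contains at most one task (counting the one being executed). If several requests target the same processor in the same slot, one of them, chosen uniformly at random, is kept and the others fail. When a request succeeds, the thief receives half of the tasks of the victim other than the one that the victim is executing: $k$ of them if there are $2k$, and $k+1$ of them if there are $2k+1$. Only the number of stolen tasks is prescribed: which tasks are stolen, and which task of its queue a processor starts next, is decided by an arbitrary rule, which may depend on the whole past of the execution (the choice of the stolen tasks may also depend on the requests of the current slot). The thief can execute the stolen tasks from the next slot on. Let $W=\sum_{j} p_j$, let $p_{\max}=\max_j p_j$, and let the makespan $C_{\max}$ be the first time at which all queues are empty. Then the execution always terminates, and $$\mathbb{E}[C_{\max}]\;\le\;\frac{W}{m}+\frac{m-1}{m}\,p_{\max}+3.24\left(\log_2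 n+\frac{1}{2\ln 2}\right)+1 .$$ -/

import Mathlib

/-! Decentralized list scheduling (DLS) of independent weighted tasks, in discrete time.
`P` is the type of processors and `T` the type of tasks. -/

namespace DLS

/-- The randomness of one time slot: for every processor `i` a processor `d.1 i ≠ i`, to which `i`
sends its steal request in case it is idle, and a ranking `d.2` of the processors, which decides
between steal requests that hit the same processor (the best-ranked one wins; under a uniformly
random ranking each of them is equally likely to win). -/
def Draw (P : Type*) [Fintype P] : Type _ :=
  ((i : P) → {k : P // k ≠ i}) × (P ≃ Fin (Fintype.card P))

instance {P : Type*} [Fintype P] [DecidableEq P] : Fintype (Draw P) :=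
  inferInstanceAs (Fintype (((i : P) → {k : P // k ≠ i}) × (P ≃ Fin (Fintype.card P))))

instance {P : Type*} [Fintype P] [Nontrivial P] : Nonempty (Draw P) :=
  ⟨(fun i => ⟨(exists_ne i).choose, (exists_ne i).choose_spec⟩, Fintype.equivFin P)⟩

instance {P : Type*} [Fintype P] : MeasurableSpace (Draw P) := ⊤

/-- The law of the draws of all time slots `0, 1, 2, …`: independent and uniform. -/
noncomputable def law (P : Type*) [Fintype P] [DecidableEq P] [Nontrivial P] :
    MeasureTheory.Measure (ℕ → Draw P) :=
  MeasureTheory.Measure.infinitePi fun _ => (PMF.uniformOfFintype (Draw P)).toMeasure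

/-- The state of the system at the beginning of a time slot. -/
structure State (P T : Type*) where
  /-- the tasks in the queue of a processor, including the task that it is executing -/
  queue : P → Finset T
  /-- the remaining processing time of a task -/
  rem : T → ℕ
  /-- the task that a processor has started and not yet completed, if any -/
  cur : P → Option T

/-- The choices which the scheduler leaves open, and which may depend on everything that
happened so far (the list of the past draws, most recent first): which task a processor starts
next, and which of the tasks that may be stolen are handed over. Only the number of the latter is
prescribed: `k` tasks out of `2k`, and `k + 1` tasks out of `2k + 1`. -/
structure Policy (P T : Type*) [Fintype P] where
  /-- the task of the nonempty queue `S` that processor `i` starts -/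
  pick : List (Draw P) → (i : P) → (S : Finset T) → T
  pick_mem : ∀ h i S, S.Nonempty → pick h i S ∈ S
  /-- the tasks given to the thief when processor `k` is robbed and `S` is the set of tasks in its
  queue which it is not executing; the history includes the draw of the current slot -/
  loot : List (Draw P) → (k : P) → (S : Finset T) → Finset T
  loot_subset : ∀ h k S, loot h k S ⊆ S
  loot_card : ∀ h k S, (loot h k S).card = (S.card + 1) / 2

section Step

variable {P T : Type*} [Fintype P] [DecidableEq P] [DecidableEq T]

/-- The task that processor `i` executes during the slot: the one that it has already started,
otherwise a task picked from its queue, and none if its queue is empty. -/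
def running (π : Policy P T) (h : List (Draw P)) (σ : State P T) (i : P) : Option T :=
  match σ.cur i with
  | some j => some j
  | none => if (σ.queue i).Nonempty then some (π.pick h i (σ.queue i)) else none

/-- Processor `i` is idle and sends a steal request to processor `k`. -/
abbrev Requests (σ : State P T) (d : Draw P) (i k : P) : Prop :=
  σ.queue i = ∅ ∧ (d.1 i : P) = k

/-- Processor `i` successfully steals from processor `k`: the queue of `k` holds more than one
task, and `i` is the best-ranked among the processors that send a request to `k`. -/
abbrev Steals (σ : State P T) (d : Draw P) (i k : P) : Prop :=
  Requests σ d i k ∧ 2 ≤ (σ.queue k).card ∧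
    ∀ i', Requests σ d i' k → d.2 i ≤ d.2 i'

/-- The remaining processing times after the slot. -/
def remAfter (π : Policy P T) (h : List (Draw P)) (σ : State P T) (j : T) : ℕ :=
  if ∃ i, running π h σ i = some j then σ.rem j - 1 else σ.rem j

/-- The tasks given away by processor `k` if it is robbed during the slot. The task that is being
executed cannot be stolen. -/
def lootOf (π : Policy P T) (h : List (Draw P)) (σ : State P T) (d : Draw P) (k : P) :
    Finset T :=
  π.loot (d :: h) k (σ.queue k \ (running π h σ k).toFinset)

/-- The tasks that leave the queue of processor `i` during the slot because they are stolen. -/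
def lost (π : Policy P T) (h : List (Draw P)) (σ : State P T) (d : Draw P) (i : P) :
    Finset T :=
  if ∃ i', Steals σ d i' i then lootOf π h σ d i else ∅

/-- The tasks that processor `i` steals during the slot. -/
def gained (π : Policy P T) (h : List (Draw P)) (σ : State P T) (d : Draw P) (i : P) :
    Finset T :=
  (Finset.univ.filter fun k => Steals σ d i k).biUnion fun k => lootOf π h σ d k

/-- One time slot: every processor with a nonempty queue executes one unit of work, every other
processor sends one steal request, and completed tasks are removed. -/
def step (π : Policy P T) (h : List (Draw P)) (σ : State P T) (d : Draw P) : State P T where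
  queue i := ((σ.queue i \ lost π h σ d i) ∪ gained π h σ d i).filter
    fun j => 0 < remAfter π h σ j
  rem := remAfter π h σ
  cur i := (running π h σ i).filter fun j => 0 < remAfter π h σ j

/-- The state reached from the initial placement `place` of the tasks after the draws `h`
(most recent first). -/
def stateAfter [Fintype T] (p : T → ℕ) (place : T → P) (π : Policy P T) :
    List (Draw P) → State P T
  | [] =>
    { queue := fun i => Finset.univ.filter fun j => place j = i
      rem := p
      cur := fun _ => none }
  | d :: h => step π h (stateAfter p place π h) d

/-- The draws of the slots `0, …, t - 1`, most recent first. -/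
def history (ω : ℕ → Draw P) : ℕ → List (Draw P)
  | 0 => []
  | t + 1 => ω t :: history ω t

/-- At time `t` all queues are empty, that is, all tasks are completed. -/
def Finished [Fintype T] (p : T → ℕ) (place : T → P) (π : Policy P T) (ω : ℕ → Draw P) (t : ℕ) :
    Prop :=
  ∀ i, (stateAfter p place π (history ω t)).queue i = ∅

/-- The makespan: the first time at which all tasks are completed. -/
noncomputable def makespan [Fintype T] (p : T → ℕ) (place : T → P) (π : Policy P T)
    (ω : ℕ → Draw P) : ℕ :=
  sInf {t | Finished p place π ω t}

end Step

end DLS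

namespace DLS

set_option linter.unusedSectionVars false

/-! Idle time is paid for by a potential that depends only on the queue lengths: the sum of `n ^ 3 -
n` over the queues. It vanishes exactly when no queue holds two tasks, and a successful steal
divides the victim's share by at least four (`pot_split`), whichever tasks move. With `m`
processors, `r` of them idle, a given busy queue is missed with probability `(1 - 1/(m-1)) ^ r`, so
the mean potential shrinks by a factor at most `exp (-r / (m * K))` with `K = 1.08 / log 2`
(`sum_potential_step_le`, `contraction_le`). By a Jensen argument for the logarithm, the idle time
spent in unbalanced slots plus `m * K * gauge potential` is a supermartingale (`sum_lyapunov_le`).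
The initial potential is at most `n ^ 3` for `n` tasks, so the mean of that idle time is at most `m
* K * (3 * log n + 1)`.

In a balanced slot every queued task is running, so there are at most `p_max` such slots before the
end, each with at most `m - 1` idle processors. Counting work and idleness over all processors
(`work_balance`) and dividing by `m` gives the bound, with `3.24 = 3 * 1.08`. -/

/-! ### Potential of a single queue -/

/-- The potential of a queue of `n` tasks. -/
def pot (n : ℕ) : ℝ := (n : ℝ) ^ 3 - n

theorem pot_mono : Monotone pot := by
  intro a b hab
  unfold pot
  rcases Nat.eq_zero_or_pos a with rfl | ha
  · rcases Nat.eq_zero_or_pos b with rfl | hb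
    · simp
    · have : (1 : ℝ) ≤ b := by exact_mod_cast hb
      simp only [Nat.cast_zero]
      nlinarith [mul_nonneg (by linarith : (0:ℝ) ≤ b) (by nlinarith : (0:ℝ) ≤ (b:ℝ) ^ 2 - 1)]
  · have h1 : (1 : ℝ) ≤ a := by exact_mod_cast ha
    have h2 : (a : ℝ) ≤ b := by exact_mod_cast hab
    nlinarith [mul_nonneg (sub_nonneg.2 h2)
      (by nlinarith : (0:ℝ) ≤ (b:ℝ) ^ 2 + a * b + (a:ℝ) ^ 2 - 1)]

theorem pot_zero : pot 0 = 0 := by simp [pot]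

theorem pot_one : pot 1 = 0 := by simp [pot]

theorem pot_nonneg (n : ℕ) : 0 ≤ pot n := pot_zero ▸ pot_mono n.zero_le

theorem six_le_pot {n : ℕ} (hn : 2 ≤ n) : 6 ≤ pot n := by
  have := pot_mono hn
  norm_num [pot] at this ⊢
  linarith

theorem pot_of_le_one {n : ℕ} (hn : n ≤ 1) : pot n = 0 := by
  interval_cases n
  exacts [pot_zero, pot_one]

/-- Splitting a queue evenly divides its potential by at least four. -/
theorem pot_split (n : ℕ) : pot (n - n / 2) + pot (n / 2) ≤ pot n / 4 := by
  obtain ⟨k, rfl | rfl⟩ := Nat.even_or_odd' n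
  · rw [show 2 * k - 2 * k / 2 = k by omega, show 2 * k / 2 = k by omega]
    unfold pot
    push_cast
    have : (0 : ℝ) ≤ k := k.cast_nonneg
    linarith
  · rw [show 2 * k + 1 - (2 * k + 1) / 2 = k + 1 by omega, show (2 * k + 1) / 2 = k by omega]
    unfold pot
    push_cast
    exact le_of_eq (by ring)

/-- Superadditivity, from `(x + y)^3 - x^3 - y^3 = 3xy(x + y)`. It makes the initial placement with
all tasks in one queue the worst. -/
theorem pot_sum_le {ι : Type*} (s : Finset ι) (f : ι → ℕ) :
    ∑ i ∈ s, pot (f i) ≤ pot (∑ i ∈ s, f i) := by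
  classical
  induction s using Finset.induction_on with
  | empty => simp [pot]
  | insert a s ha ih =>
    rw [Finset.sum_insert ha, Finset.sum_insert ha]
    refine (add_le_add_right ih _).trans ?_
    generalize f a = x
    generalize ∑ i ∈ s, f i = y
    unfold pot
    push_cast
    have : (0 : ℝ) ≤ 3 * x * y * (x + y) := by positivity
    nlinarith

theorem pot_le_cube (n : ℕ) : pot n ≤ (n : ℝ) ^ 3 := by
  unfold pot
  linarith [(n.cast_nonneg : (0 : ℝ) ≤ n)]

/-! ### Exponential bound on the contraction factor -/

/-- The origin of 1.08: the left side is just below 0.526 and `2 ^ (-1/1.08)` just above. -/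
theorem contraction_at_one : 1 / 4 + 3 / 4 * Real.exp (-1) ≤ Real.exp (-(Real.log 2 / 1.08)) := by
  have h1 : Real.exp (-1) ≤ 0.368 := by
    rw [Real.exp_neg]
    refine inv_le_of_inv_le₀ (by norm_num) ?_
    have := Real.exp_one_gt_d9
    norm_num at this ⊢
    linarith
  have h2 : (0.526 : ℝ) ≤ Real.exp (-(Real.log 2 / 1.08)) := by
    rw [← Real.log_le_iff_le_exp (by norm_num)]
    -- As `0.526 = 1.052 / 2` and `1 - 1/1.08 = 2/27`, the claim amounts to `1.052 ^ 27 ≤ 2 ^ 2`.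
    have h3 : Real.log ((1.052 : ℝ) ^ 27) ≤ Real.log (2 ^ 2) :=
      Real.log_le_log (by positivity) (by norm_num)
    rw [Real.log_pow, Real.log_pow] at h3
    have h4 : Real.log (0.526 : ℝ) = Real.log 1.052 - Real.log 2 := by
      rw [← Real.log_div (by norm_num) (by norm_num)]
      norm_num
    rw [h4]
    push_cast at h3
    norm_num
    linarith
  linarith

/-- Convexity of `x ^ (1/β)` reduces the claim to `β = 1`: the power of the average of `1` and `exp
(-β)` is at most the average of `1` and `exp (-1)`. -/
theorem contraction_le_exp {β : ℝ} (h0 : 0 ≤ β) (h1 : β ≤ 1) :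
    1 / 4 + 3 / 4 * Real.exp (-β) ≤ Real.exp (-(β * (Real.log 2 / 1.08))) := by
  rcases h0.eq_or_lt with rfl | h0
  · norm_num
  have hp : 1 ≤ 1 / β := by rw [le_div_iff₀ h0]; linarith
  have key := (convexOn_rpow hp).2 (Set.mem_Ici.2 zero_le_one)
    (Set.mem_Ici.2 (Real.exp_pos (-β)).le) (by norm_num : (0 : ℝ) ≤ 1 / 4)
    (by norm_num : (0 : ℝ) ≤ 3 / 4) (by norm_num)
  simp only [smul_eq_mul] at key
  rw [Real.one_rpow, ← Real.exp_mul, show -β * (1 / β) = -1 by field_simp, mul_one] at key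
  have pos : 0 < 1 / 4 + 3 / 4 * Real.exp (-β) := by positivity
  have := Real.rpow_le_rpow (by positivity) (key.trans contraction_at_one) h0.le
  rw [← Real.rpow_mul pos.le, ← Real.exp_mul, one_div_mul_cancel h0.ne', Real.rpow_one] at this
  refine this.trans (le_of_eq ?_)
  ring_nf

/-- The contraction factor of the potential in a slot with `r` steal requests. -/
theorem contraction_le {m r : ℕ} (hm : 2 ≤ m) (hr : r ≤ m - 1) :
    1 / 4 + 3 / 4 * (1 - 1 / ((m : ℝ) - 1)) ^ r ≤ Real.exp (-(r / (m * (1.08 / Real.log 2)))) := by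
  have hm' : (2 : ℝ) ≤ m := by exact_mod_cast hm
  have hr' : (r : ℝ) ≤ m - 1 := by
    have : r + 1 ≤ m := by omega
    have : (r : ℝ) + 1 ≤ m := by exact_mod_cast this
    linarith
  have hM : (0 : ℝ) < m - 1 := by linarith
  have hlog : 0 < Real.log 2 := Real.log_pos (by norm_num)
  have hx : (1 - 1 / ((m : ℝ) - 1)) ^ r ≤ Real.exp (-(r / ((m : ℝ) - 1))) := by
    have h1 : 1 - 1 / ((m : ℝ) - 1) ≤ Real.exp (-(1 / ((m : ℝ) - 1))) := by
      have := Real.add_one_le_exp (-(1 / ((m : ℝ) - 1)))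
      linarith
    have h0 : 0 ≤ 1 - 1 / ((m : ℝ) - 1) := by
      rw [sub_nonneg, div_le_one hM]; linarith
    refine (pow_le_pow_left₀ h0 h1 r).trans (le_of_eq ?_)
    rw [← Real.exp_nat_mul]
    ring_nf
  have hβ := contraction_le_exp (β := r / ((m : ℝ) - 1)) (by positivity)
    ((div_le_one hM).2 hr')
  refine (by linarith : _ ≤ _).trans (hβ.trans (Real.exp_le_exp.2 (neg_le_neg ?_)))
  rw [show (r : ℝ) / (m * (1.08 / Real.log 2)) = r / m * (Real.log 2 / 1.08) by field_simp]
  refine mul_le_mul_of_nonneg_right ?_ (by positivity)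
  -- Weakening `m - 1` to `m` makes the final coefficient of the logarithm independent of `m`.
  exact div_le_div_of_nonneg_left (by positivity) hM (by linarith)

/-! ### Jensen's inequality for the logarithm with a value at zero -/

/-- A concave gauge of the potential, up to rounding between `0` and `1`. -/
noncomputable def gauge (y : ℝ) : ℝ := if y = 0 then 0 else Real.log y + 1

theorem gauge_nonneg {y : ℝ} (hy : y = 0 ∨ 1 ≤ y) : 0 ≤ gauge y := by
  unfold gauge
  split_ifs with h
  · exact le_rfl
  · have := Real.log_nonneg (hy.resolve_left h)
    linarith

/-- The right side is the tangent of `log + 1` at `z`. At `y = 0` it equals `log z`, hence the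
condition `1 ≤ z`. -/
theorem gauge_le_tangent {y z : ℝ} (hy : 0 ≤ y) (hz : 1 ≤ z) :
    gauge y ≤ Real.log z + y / z := by
  unfold gauge
  split_ifs with h
  · have := Real.log_nonneg hz
    simp [h, this]
  · have hz0 : 0 < z := by linarith
    have hy0 : 0 < y := lt_of_le_of_ne hy (Ne.symm h)
    have := Real.log_le_sub_one_of_pos (div_pos hy0 hz0)
    rw [Real.log_div hy0.ne' hz0.ne'] at this
    linarith

/-- Jensen's inequality for `gauge` and a nonnegative variable whose mean is at most `c * y`. -/
theorem avg_gauge_le {ι : Type*} [Fintype ι] [Nonempty ι] {f : ι → ℝ} (hf : ∀ i, 0 ≤ f i)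
    {y c a : ℝ} (hy : 6 ≤ y) (hc : 1 / 4 ≤ c) (hca : c ≤ Real.exp (-a))
    (hmean : ∑ i, f i ≤ Fintype.card ι * (c * y)) :
    ∑ i, gauge (f i) ≤ Fintype.card ι * (gauge y - a) := by
  -- The tangent is taken at the bound on the mean; `6 * (1/4) ≥ 1` makes this point admissible.
  have hz : 1 ≤ c * y := by nlinarith
  have hz0 : 0 < c * y := by linarith
  have hcard : (0 : ℝ) < Fintype.card ι := by exact_mod_cast Fintype.card_pos
  calc ∑ i, gauge (f i) ≤ ∑ i, (Real.log (c * y) + f i / (c * y)) :=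
        Finset.sum_le_sum fun i _ => gauge_le_tangent (hf i) hz
    _ = Fintype.card ι * Real.log (c * y) + (∑ i, f i) / (c * y) := by
        rw [Finset.sum_add_distrib, Finset.sum_div]; simp
    _ ≤ Fintype.card ι * Real.log (c * y) + Fintype.card ι := by
        gcongr; rwa [div_le_iff₀ hz0]
    _ ≤ Fintype.card ι * (gauge y - a) := by
        have h1 : Real.log c ≤ -a := (Real.log_le_iff_le_exp (by linarith)).2 hca
        rw [gauge, if_neg (by linarith), Real.log_mul (by linarith) (by linarith)]
        nlinarith

/-! ### Invariants and effect of one slot -/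

section Step

variable {P T : Type*} [Fintype P] [DecidableEq P] [DecidableEq T]

/-- Invariants of the reachable states: a started task is in the queue of its processor, the queues
are disjoint, and queued tasks are not completed. -/
structure State.Valid (σ : State P T) : Prop where
  cur_mem : ∀ i j, σ.cur i = some j → j ∈ σ.queue i
  eq_of_mem : ∀ i i' j, j ∈ σ.queue i → j ∈ σ.queue i' → i = i'
  rem_pos : ∀ i j, j ∈ σ.queue i → 0 < σ.rem j

/-- The idle processors. -/
def idle (σ : State P T) : Finset P := Finset.univ.filter fun i => σ.queue i = ∅

/-- The potential of a state. -/
def potential (σ : State P T) : ℝ := ∑ i, pot (σ.queue i).card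

variable {π : Policy P T} {h : List (Draw P)} {σ : State P T} {d : Draw P}

theorem mem_idle {i : P} : i ∈ idle σ ↔ σ.queue i = ∅ := by simp [idle]

theorem running_mem (hσ : σ.Valid) {i : P} {j : T} (hj : running π h σ i = some j) :
    j ∈ σ.queue i := by
  unfold running at hj
  split at hj
  · rename_i j' hc
    exact hσ.cur_mem i j (hc.trans hj)
  · split_ifs at hj with hne
    cases hj
    exact π.pick_mem h i _ hne

theorem exists_running (i : P) (hne : (σ.queue i).Nonempty) :
    ∃ j, running π h σ i = some j := by
  unfold running
  split
  · exact ⟨_, rfl⟩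
  · exact ⟨_, if_pos hne⟩

theorem lootOf_subset (k : P) : lootOf π h σ d k ⊆ σ.queue k :=
  (π.loot_subset _ _ _).trans Finset.sdiff_subset

theorem running_notMem_lootOf {k : P} {j : T} (hj : running π h σ k = some j) :
    j ∉ lootOf π h σ d k := fun hm => by
  have := π.loot_subset _ _ _ hm
  simp [hj] at this

/-- The running task is excluded, so rounding up half of `c - 1` tasks gives `c / 2` rounded down,
the split in `pot_split`. -/
theorem card_lootOf (hσ : σ.Valid) {k : P} (hne : (σ.queue k).Nonempty) :
    (lootOf π h σ d k).card = (σ.queue k).card / 2 := by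
  obtain ⟨j, hj⟩ := exists_running (π := π) (h := h) k hne
  have hm := running_mem hσ hj
  rw [lootOf, π.loot_card, hj, Option.toFinset_some, Finset.card_sdiff_of_subset (by simpa using hm),
    Finset.card_singleton]
  have := hne.card_pos
  omega

theorem Steals.eq_target {i k k' : P} (hk : Steals σ d i k) (hk' : Steals σ d i k') : k = k' :=
  hk.1.2.symm.trans hk'.1.2

theorem Steals.eq_thief {i i' k : P} (hi : Steals σ d i k) (hi' : Steals σ d i' k) : i = i' :=
  d.2.injective (le_antisymm (hi.2.2 _ hi'.1) (hi'.2.2 _ hi.1))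

theorem exists_steals {k : P} (hk : 2 ≤ (σ.queue k).card) (hr : ∃ i, Requests σ d i k) :
    ∃ i, Steals σ d i k := by
  obtain ⟨i, hi⟩ := hr
  obtain ⟨i₀, h₀, hmin⟩ := Finset.exists_min_image
    (Finset.univ.filter fun i => Requests σ d i k) d.2 ⟨i, by simpa using hi⟩
  exact ⟨i₀, (Finset.mem_filter.1 h₀).2, hk,
    fun i' hi' => hmin i' (Finset.mem_filter.2 ⟨Finset.mem_univ _, hi'⟩)⟩

theorem mem_gained {i : P} {j : T} :
    j ∈ gained π h σ d i ↔ ∃ k, Steals σ d i k ∧ j ∈ lootOf π h σ d k := by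
  simp [gained]

theorem lost_of_steals {i k : P} (hs : Steals σ d i k) : lost π h σ d k = lootOf π h σ d k :=
  if_pos ⟨i, hs⟩

theorem mem_step_queue {i : P} {j : T} :
    j ∈ (step π h σ d).queue i ↔
      ((j ∈ σ.queue i ∧ j ∉ lost π h σ d i) ∨
        ∃ k, Steals σ d i k ∧ j ∈ lootOf π h σ d k) ∧ 0 < remAfter π h σ j := by
  simp only [step, Finset.mem_filter, Finset.mem_union, Finset.mem_sdiff, mem_gained]

theorem exists_mem_queue_of_step {i : P} {j : T} (hj : j ∈ (step π h σ d).queue i) :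
    ∃ k, j ∈ σ.queue k := by
  rcases (mem_step_queue.1 hj).1 with hj | ⟨k, -, hj⟩
  exacts [⟨i, hj.1⟩, ⟨k, lootOf_subset k hj⟩]

theorem State.Valid.step (hσ : σ.Valid) : (step π h σ d).Valid where
  cur_mem i j hj := by
    obtain ⟨hr, hpos⟩ := Option.filter_eq_some_iff.1 hj
    refine mem_step_queue.2 ⟨Or.inl ⟨running_mem hσ hr, fun hl => ?_⟩, by simpa using hpos⟩
    unfold lost at hl
    split_ifs at hl
    · exact running_notMem_lootOf hr hl
    · simp at hl
  eq_of_mem i i' j hj hj' := by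
    rcases (mem_step_queue.1 hj).1 with ⟨h1, h2⟩ | ⟨k, hk, h1⟩ <;>
    rcases (mem_step_queue.1 hj').1 with ⟨h1', h2'⟩ | ⟨k', hk', h1'⟩
    · exact hσ.eq_of_mem _ _ _ h1 h1'
    · obtain rfl := hσ.eq_of_mem _ _ _ h1 (lootOf_subset _ h1')
      exact absurd (lost_of_steals hk' ▸ h1') h2
    · obtain rfl := hσ.eq_of_mem _ _ _ h1' (lootOf_subset _ h1)
      exact absurd (lost_of_steals hk ▸ h1) h2'
    · obtain rfl := hσ.eq_of_mem _ _ _ (lootOf_subset _ h1) (lootOf_subset _ h1')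
      exact hk.eq_thief hk'
  rem_pos i j hj := (mem_step_queue.1 hj).2

/-! ### The work -/

theorem remAfter_le (j : T) : remAfter π h σ j ≤ σ.rem j := by
  unfold remAfter
  split_ifs <;> omega

/-- In every slot, each busy processor executes one unit of work. -/
theorem sum_remAfter [Fintype T] (hσ : σ.Valid) :
    ∑ j, remAfter π h σ j + Fintype.card P = ∑ j, σ.rem j + (idle σ).card := by
  choose f hf using fun i : {i // i ∉ idle σ} => exists_running (π := π) (h := h) i.1
    (Finset.nonempty_iff_ne_empty.2 fun h0 => i.2 (mem_idle.2 h0))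
  -- Disjoint queues force distinct busy processors to run distinct tasks.
  have hinj : Function.Injective f := fun i i' hii => Subtype.ext <|
    hσ.eq_of_mem _ _ _ (running_mem hσ (hf i)) (hii ▸ running_mem hσ (hf i'))
  have hcard : (Finset.univ.filter fun j => ∃ i, running π h σ i = some j).card + (idle σ).card
      = Fintype.card P := by
    rw [← Finset.card_compl_add_card (idle σ), add_left_inj,
      show (Finset.univ.filter fun j => ∃ i, running π h σ i = some j) = Finset.univ.image f from ?_,
      Finset.card_image_of_injective _ hinj, Finset.card_univ, Fintype.card_subtype]
    · congr 1
      ext i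
      simp
    · ext j
      simp only [Finset.mem_filter, Finset.mem_univ, true_and, Finset.mem_image]
      constructor
      · rintro ⟨i, hi⟩
        have hi' : i ∉ idle σ := fun h0 => by
          have := running_mem hσ hi
          rw [mem_idle.1 h0] at this
          simp at this
        exact ⟨⟨i, hi'⟩, Option.some_injective _ ((hf _).symm.trans hi)⟩
      · rintro ⟨i, rfl⟩
        exact ⟨_, hf i⟩
  have hsum : ∑ j, σ.rem j = ∑ j, remAfter π h σ j
      + (Finset.univ.filter fun j => ∃ i, running π h σ i = some j).card := by
    rw [Finset.card_filter, ← Finset.sum_add_distrib]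
    refine Finset.sum_congr rfl fun j _ => ?_
    unfold remAfter
    split_ifs with hj
    · obtain ⟨i, hi⟩ := hj
      have := hσ.rem_pos i j (running_mem hσ hi)
      omega
    · rfl
  omega

/-! ### The potential -/

theorem potential_nonneg (σ : State P T) : 0 ≤ potential σ := Finset.sum_nonneg fun _ _ => pot_nonneg _

theorem potential_eq_zero_or (σ : State P T) :
    (potential σ = 0 ∧ ∀ i, (σ.queue i).card ≤ 1) ∨
      (6 ≤ potential σ ∧ ∃ i, 2 ≤ (σ.queue i).card) := by
  by_cases h1 : ∀ i, (σ.queue i).card ≤ 1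
  · exact Or.inl ⟨Finset.sum_eq_zero fun i _ => pot_of_le_one (h1 i), h1⟩
  · push Not at h1
    obtain ⟨i, hi⟩ := h1
    exact Or.inr ⟨(six_le_pot hi).trans
      (Finset.single_le_sum (f := fun i => pot (σ.queue i).card)
        (fun _ _ => pot_nonneg _) (Finset.mem_univ i)), i, hi⟩

/-- The potential after a slot, queue by queue. -/
theorem potential_step_le (hσ : σ.Valid) :
    potential (step π h σ d) ≤
      ∑ k, pot (σ.queue k).card * (1 / 4 + 3 / 4 * if ∃ i, Requests σ d i k then 0 else 1) := by
  have hq : ∀ i, pot ((step π h σ d).queue i).card ≤ pot (σ.queue i \ lost π h σ d i).card +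
      ∑ k, if Steals σ d i k then pot (lootOf π h σ d k).card else 0 := by
    intro i
    have hnn : 0 ≤ ∑ k, if Steals σ d i k then pot (lootOf π h σ d k).card else 0 :=
      Finset.sum_nonneg fun k _ => by split_ifs; exacts [pot_nonneg _, le_rfl]
    by_cases hi : ∃ k, Steals σ d i k
    · obtain ⟨k, hk⟩ := hi
      -- A thief starts the slot with an empty queue and has a single victim, so it ends with
      -- nothing but that loot.
      have hsub : (step π h σ d).queue i ⊆ lootOf π h σ d k := fun j hj => by
        rcases (mem_step_queue.1 hj).1 with hj | ⟨k', hk', hj⟩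
        · rw [hk.1.1] at hj
          simp at hj
        · exact hk.eq_target hk' ▸ hj
      calc pot ((step π h σ d).queue i).card ≤ pot (lootOf π h σ d k).card :=
            pot_mono (Finset.card_le_card hsub)
        _ = if Steals σ d i k then pot (lootOf π h σ d k).card else 0 := (if_pos hk).symm
        _ ≤ ∑ k, if Steals σ d i k then pot (lootOf π h σ d k).card else 0 :=
            Finset.single_le_sum
              (f := fun k => if Steals σ d i k then pot (lootOf π h σ d k).card else 0)
              (fun k _ => by split_ifs; exacts [pot_nonneg _, le_rfl])
              (Finset.mem_univ k)
        _ ≤ _ := le_add_of_nonneg_left (pot_nonneg _)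
    · have hsub : (step π h σ d).queue i ⊆ σ.queue i \ lost π h σ d i := fun j hj => by
        rcases (mem_step_queue.1 hj).1 with hj | ⟨k', hk', -⟩
        · exact Finset.mem_sdiff.2 hj
        · exact absurd ⟨k', hk'⟩ hi
      exact (pot_mono (Finset.card_le_card hsub)).trans (le_add_of_nonneg_right hnn)
  refine (Finset.sum_le_sum fun i _ => hq i).trans ?_
  -- Exchanging the sums charges the loot to the victim instead of the thief.
  rw [Finset.sum_add_distrib, Finset.sum_comm, ← Finset.sum_add_distrib]
  refine Finset.sum_le_sum fun k _ => ?_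
  by_cases hk : 2 ≤ (σ.queue k).card
  · split_ifs with hr
    · obtain ⟨i, hi⟩ := exists_steals hk hr
      have hne : (σ.queue k).Nonempty := Finset.card_pos.1 (by omega)
      have hone : (∑ i', if Steals σ d i' k then pot (lootOf π h σ d k).card else 0)
          = pot (lootOf π h σ d k).card := by
        rw [Finset.sum_eq_single_of_mem i (Finset.mem_univ i)
          fun i' _ hne' => if_neg fun hi' => hne' (hi'.eq_thief hi), if_pos hi]
      rw [hone, lost_of_steals hi, Finset.card_sdiff_of_subset (lootOf_subset k),
        card_lootOf hσ hne]
      have := pot_split (σ.queue k).card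
      linarith
    · have hz : (∑ i', if Steals σ d i' k then pot (lootOf π h σ d k).card else 0) = 0 :=
        Finset.sum_eq_zero fun i' _ => if_neg fun hi' => hr ⟨i', hi'.1⟩
      rw [hz]
      have := pot_mono (Finset.card_le_card
        (Finset.sdiff_subset : σ.queue k \ lost π h σ d k ⊆ σ.queue k))
      linarith
  · have hz : (∑ i', if Steals σ d i' k then pot (lootOf π h σ d k).card else 0) = 0 :=
      Finset.sum_eq_zero fun i' _ => if_neg fun hi' => hk hi'.2.1
    have := pot_mono (Finset.card_le_card
        (Finset.sdiff_subset : σ.queue k \ lost π h σ d k ⊆ σ.queue k))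
    rw [pot_of_le_one (by omega : (σ.queue k).card ≤ 1)] at this ⊢
    rw [hz]
    linarith

/-! ### Counting the draws that miss a queue -/

theorem card_draw : Fintype.card (Draw P) =
    (∏ _ : P, (Fintype.card P - 1)) * Fintype.card (P ≃ Fin (Fintype.card P)) := by
  refine (Fintype.card_prod _ _).trans ?_
  rw [Fintype.card_pi]
  simp [Fintype.card_subtype_compl]

/-- The number of draws in which nobody sends a request to the busy processor `k`. -/
theorem card_not_requested {k : P} (hk : k ∉ idle σ) :
    (Finset.univ.filter fun d : Draw P => ¬ ∃ i, Requests σ d i k).card =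
      (∏ i : P, (Fintype.card P - 1 - if i ∈ idle σ then 1 else 0)) *
        Fintype.card (P ≃ Fin (Fintype.card P)) := by
  -- Missing `k` is a product condition: each idle processor avoids one of its `m - 1` targets,
  -- while busy processors and the ranking are unconstrained.
  have hset : (Finset.univ.filter fun d : Draw P => ¬ ∃ i, Requests σ d i k) =
      (Fintype.piFinset fun i : P =>
        Finset.univ.filter fun a : {k : P // k ≠ i} => i ∈ idle σ → (a : P) ≠ k) ×ˢ
        (Finset.univ : Finset (P ≃ Fin (Fintype.card P))) := by
    ext d
    simp only [Finset.mem_filter, Finset.mem_univ, true_and, Requests, not_exists, not_and]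
    refine Iff.trans ?_ Finset.mem_product.symm
    simp [Fintype.mem_piFinset, mem_idle]
  rw [hset]
  refine (Finset.card_product _ _).trans ?_
  rw [Fintype.card_piFinset, Finset.card_univ]
  congr 1
  refine Finset.prod_congr rfl fun i _ => ?_
  by_cases hi : i ∈ idle σ
  · have hki : k ≠ i := fun h0 => hk (h0 ▸ hi)
    have : (Finset.univ.filter fun a : {k : P // k ≠ i} => i ∈ idle σ → (a : P) ≠ k)
        = Finset.univ.erase ⟨k, hki⟩ := by
      ext a
      simp [hi, Subtype.ext_iff]
    rw [this, Finset.card_erase_of_mem (Finset.mem_univ _), if_pos hi, Finset.card_univ]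
    simp [Fintype.card_subtype_compl]
  · simp [hi, Fintype.card_subtype_compl]

theorem two_le_card (P : Type*) [Fintype P] [Nontrivial P] : 2 ≤ Fintype.card P :=
  Fintype.one_lt_card

/-- The probability that nobody sends a request to the busy processor `k`. -/
theorem sum_not_requested [Nontrivial P] {k : P} (hk : k ∉ idle σ) :
    (∑ d : Draw P, if ∃ i, Requests σ d i k then (0 : ℝ) else 1) =
      Fintype.card (Draw P) * (1 - 1 / ((Fintype.card P : ℝ) - 1)) ^ (idle σ).card := by
  have hm := two_le_card P
  have hM : ((Fintype.card P - 1 : ℕ) : ℝ) = (Fintype.card P : ℝ) - 1 := by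
    push_cast [Nat.cast_sub (by omega : 1 ≤ Fintype.card P)]; ring
  have hM0 : (Fintype.card P : ℝ) - 1 ≠ 0 := by
    rw [← hM]; exact_mod_cast (by omega : Fintype.card P - 1 ≠ 0)
  have h1 : (∑ d : Draw P, if ∃ i, Requests σ d i k then (0 : ℝ) else 1) =
      ((Finset.univ.filter fun d : Draw P => ¬ ∃ i, Requests σ d i k).card : ℝ) := by
    rw [Finset.card_filter]
    push_cast
    refine Finset.sum_congr rfl fun d _ => ?_
    split_ifs <;> simp_all
  rw [h1, card_not_requested hk, card_draw]
  push_cast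
  rw [mul_right_comm, ← Finset.prod_const (s := idle σ), ← Finset.prod_filter_mul_prod_filter_not
    Finset.univ (· ∈ idle σ)]
  rw [← Finset.prod_filter_mul_prod_filter_not Finset.univ (· ∈ idle σ)
    (fun _ => ((Fintype.card P - 1 : ℕ) : ℝ))]
  have hid : Finset.univ.filter (· ∈ idle σ) = idle σ := by ext; simp
  rw [hid, mul_right_comm _ (∏ x ∈ _, _) (∏ i ∈ idle σ, (1 - _)), ← Finset.prod_mul_distrib]
  congr 2
  · refine Finset.prod_congr rfl fun _ hi => ?_
    rw [if_pos hi, Nat.cast_sub (by omega), hM]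
    field_simp
    push_cast
    ring
  · refine Finset.prod_congr rfl fun _ hi => ?_
    rw [if_neg (Finset.mem_filter.1 hi).2, Nat.sub_zero]

/-- The mean potential after a slot. -/
theorem sum_potential_step_le [Nontrivial P] (hσ : σ.Valid) :
    ∑ d, potential (step π h σ d) ≤ Fintype.card (Draw P) *
      ((1 / 4 + 3 / 4 * (1 - 1 / ((Fintype.card P : ℝ) - 1)) ^ (idle σ).card) * potential σ) := by
  refine (Finset.sum_le_sum fun d _ => potential_step_le hσ).trans (le_of_eq ?_)
  rw [Finset.sum_comm, potential, Finset.mul_sum, Finset.mul_sum]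
  refine Finset.sum_congr rfl fun k _ => ?_
  rw [← Finset.mul_sum, Finset.sum_add_distrib, ← Finset.mul_sum]
  -- The miss probability is only computed for busy `k`; an idle one has no potential.
  by_cases hk : k ∈ idle σ
  · simp [mem_idle.1 hk, pot_zero]
  · rw [sum_not_requested hk]
    simp only [Finset.sum_const, Finset.card_univ, nsmul_eq_mul]
    ring

end Step

open MeasureTheory ProbabilityTheory

/-! ### Independent draws and supermartingales -/

section Prob
variable {P : Type*} [Fintype P] [DecidableEq P]

theorem history_congr {ω ω' : ℕ → Draw P} (t : ℕ) (hω : ∀ s < t, ω s = ω' s) :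
    history ω t = history ω' t := by
  induction t with
  | zero => rfl
  | succ t ih =>
    rw [history, history, hω t t.lt_succ_self, ih fun s hs => hω s (by omega)]

/-- There are finitely many histories of a given length. -/
theorem exists_bound_history (t : ℕ) (f : List (Draw P) → ℝ) :
    ∃ C, ∀ ω : ℕ → Draw P, |f (history ω t)| ≤ C := by
  induction t generalizing f with
  | zero => exact ⟨|f []|, fun _ => le_rfl⟩
  | succ t ih =>
    choose C hC using fun d => ih fun l => f (d :: l)
    exact ⟨∑ d, C d, fun ω => (hC (ω t) ω).trans (Finset.single_le_sum (f := C)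
      (fun d _ => (abs_nonneg _).trans (hC d ω)) (Finset.mem_univ _))⟩

instance : DiscreteMeasurableSpace (Draw P) := ⟨fun _ => trivial⟩

theorem measurable_history {β : Type*} [MeasurableSpace β] (t : ℕ) (f : List (Draw P) → β) :
    Measurable fun ω : ℕ → Draw P => f (history ω t) := by
  induction t generalizing f with
  | zero => exact measurable_const (a := f [])
  | succ t ih =>
    have h1 : Measurable fun x : Draw P × (ℕ → Draw P) => f (x.1 :: history x.2 t) :=
      measurable_from_prod_countable_right fun d => ih fun l => f (d :: l)
    have h2 : Measurable fun ω : ℕ → Draw P => (ω t, ω) :=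
      (measurable_pi_apply t).prodMk measurable_id
    exact h1.comp h2

variable [Nontrivial P]

instance : IsProbabilityMeasure (law P) := by unfold law; infer_instance

theorem integrable_history (t : ℕ) (f : List (Draw P) → ℝ) :
    Integrable (fun ω => f (history ω t)) (law P) := by
  obtain ⟨C, hC⟩ := exists_bound_history t f
  exact Integrable.of_bound (measurable_history t f).aestronglyMeasurable C
    (Filter.Eventually.of_forall hC)

theorem law_eval (t : ℕ) (d : Draw P) :
    (law P).real {ω | ω t = d} = (Fintype.card (Draw P) : ℝ)⁻¹ := by
  have h1 : (law P).map (fun ω => ω t) = (PMF.uniformOfFintype (Draw P)).toMeasure :=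
    Measure.infinitePi_map_eval _ t
  have h2 : law P {ω | ω t = d} = (Fintype.card (Draw P) : ENNReal)⁻¹ := by
    rw [show {ω : ℕ → Draw P | ω t = d} = (fun ω => ω t) ⁻¹' {d} from rfl,
      ← Measure.map_apply (measurable_pi_apply t) (measurableSet_singleton d), h1,
      PMF.toMeasure_apply_singleton _ _ (measurableSet_singleton d),
      PMF.uniformOfFintype_apply]
  simp [Measure.real, h2]

theorem indepFun_history (t : ℕ) {β γ : Type*} [MeasurableSpace β] [MeasurableSpace γ]
    (g : Draw P → γ) (f : List (Draw P) → β) :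
    IndepFun (fun ω : ℕ → Draw P => g (ω t)) (fun ω => f (history ω t)) (law P) := by
  have hind : iIndepFun (fun (i : ℕ) (ω : ℕ → Draw P) => ω i) (law P) :=
    iIndepFun_infinitePi (X := fun _ => id) fun _ => measurable_id
  have h1 := hind.indepFun_finset {t} (Finset.range t) (by simp) fun i => measurable_pi_apply i
  classical
  -- The first `t` draws are padded to a full sequence by an arbitrary value, which `history` at
  -- time `t` never reads.
  let ext (x : Finset.range t → Draw P) (s : ℕ) : Draw P :=
    if hs : s ∈ Finset.range t then x ⟨s, hs⟩ else Classical.arbitrary _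
  have hext : Measurable ext := measurable_pi_lambda _ fun s => by
    by_cases hs : s ∈ Finset.range t
    · simpa only [ext, dif_pos hs] using measurable_pi_apply _
    · simpa only [ext, dif_neg hs] using measurable_const
  have h2 := h1.comp
    (φ := fun x : ({t} : Finset ℕ) → Draw P => g (x ⟨t, Finset.mem_singleton_self t⟩))
    (ψ := fun x => f (history (ext x) t))
    ((measurable_of_countable g).comp (measurable_pi_apply _))
    ((measurable_history t f).comp hext)
  have h3 : (fun ω => f (history ω t)) =
      (fun x => f (history (ext x) t)) ∘ fun (ω : ℕ → Draw P) (i : Finset.range t) => ω i :=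
    funext fun ω => congrArg f (history_congr t fun s hs => by simp [ext, hs])
  rw [h3]
  exact h2

/-- One step of conditioning on the past draws. -/
theorem integral_history_succ (t : ℕ) (f : List (Draw P) → ℝ) :
    ∫ ω, f (history ω (t + 1)) ∂law P =
      ∫ ω, (Fintype.card (Draw P) : ℝ)⁻¹ * ∑ d, f (d :: history ω t) ∂law P := by
  classical
  have h1 : ∀ ω : ℕ → Draw P, f (history ω (t + 1)) =
      ∑ d, (if ω t = d then (1 : ℝ) else 0) * f (d :: history ω t) := fun ω => by
    simp [history]
  have hm (d : Draw P) : Measurable fun ω : ℕ → Draw P => if ω t = d then (1 : ℝ) else 0 :=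
    (measurable_of_countable fun x => if x = d then (1 : ℝ) else 0).comp (measurable_pi_apply t)
  have hi (d : Draw P) : IndepFun (fun ω : ℕ → Draw P => if ω t = d then (1 : ℝ) else 0)
      (fun ω => f (d :: history ω t)) (law P) :=
    indepFun_history t (fun x => if x = d then (1 : ℝ) else 0) fun l => f (d :: l)
  have hint (d : Draw P) : Integrable (fun ω : ℕ → Draw P => if ω t = d then (1 : ℝ) else 0)
      (law P) :=
    Integrable.of_bound (hm d).aestronglyMeasurable 1
      (Filter.Eventually.of_forall fun ω => by split_ifs <;> simp)
  have hone (d : Draw P) : ∫ ω : ℕ → Draw P, (if ω t = d then (1 : ℝ) else 0) ∂law P =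
      (Fintype.card (Draw P) : ℝ)⁻¹ := by
    have h0 : Measurable fun ω : ℕ → Draw P => ω t := measurable_pi_apply t
    have hs : MeasurableSet {ω : ℕ → Draw P | ω t = d} := h0 (measurableSet_singleton d)
    rw [← law_eval t d, ← integral_indicator_one hs]
    refine integral_congr_ae (Filter.Eventually.of_forall fun ω => ?_)
    by_cases hd : ω t = d <;> simp [hd]
  simp only [h1]
  rw [integral_finsetSum, integral_const_mul, integral_finsetSum, Finset.mul_sum]
  · refine Finset.sum_congr rfl fun d _ => ?_
    rw [← hone d]
    exact (hi d).integral_fun_mul_eq_mul_integral (hm d).aestronglyMeasurable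
      (measurable_history t fun l => f (d :: l)).aestronglyMeasurable
  · exact fun d _ => integrable_history t fun l => f (d :: l)
  · exact fun d _ => (hi d).integrable_mul (hint d) (integrable_history t fun l => f (d :: l))

/-- A function of the history that does not increase on average is a supermartingale. -/
theorem integral_history_le (f : List (Draw P) → ℝ)
    (hf : ∀ l, ∑ d, f (d :: l) ≤ Fintype.card (Draw P) * f l) (t : ℕ) :
    ∫ ω, f (history ω t) ∂law P ≤ f [] := by
  have hc : (0 : ℝ) < Fintype.card (Draw P) := by exact_mod_cast Fintype.card_pos
  induction t with
  | zero => simp [history]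
  | succ t ih =>
    rw [integral_history_succ]
    refine (integral_mono (integrable_history t fun l => (Fintype.card (Draw P) : ℝ)⁻¹ *
      ∑ d, f (d :: l)) (integrable_history t f) fun ω => ?_).trans ih
    dsimp only
    rw [inv_mul_le_iff₀ hc]
    exact hf _

end Prob

/-! ### Pathwise accounting of work and idle time -/

section Makespan

variable {P T : Type*} [Fintype P] [DecidableEq P] [Fintype T] [DecidableEq T]

/-- Some queue holds at least two tasks. -/
abbrev Unbalanced (σ : State P T) : Prop := ∃ i, 2 ≤ (σ.queue i).card

/-- The number of idle processors, summed over the past slots in which the state was unbalanced. -/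
def idleUnbalanced (p : T → ℕ) (place : T → P) (π : Policy P T) : List (Draw P) → ℕ
  | [] => 0
  | _ :: h => idleUnbalanced p place π h +
      if Unbalanced (stateAfter p place π h) then (idle (stateAfter p place π h)).card else 0

/-- The number of past slots in which no queue held more than one task. -/
def balancedSlots (p : T → ℕ) (place : T → P) (π : Policy P T) : List (Draw P) → ℕ
  | [] => 0
  | _ :: h => balancedSlots p place π h + if Unbalanced (stateAfter p place π h) then 0 else 1

variable {p : T → ℕ} {place : T → P} {π : Policy P T}

theorem valid_stateAfter (hp : ∀ j, 0 < p j) (h : List (Draw P)) :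
    (stateAfter p place π h).Valid := by
  induction h with
  | nil =>
    exact ⟨by simp [stateAfter], by rintro i i' j hi hi'; simp_all [stateAfter],
      fun i j _ => hp j⟩
  | cons d h ih => exact ih.step

theorem potential_of_not_unbalanced {σ : State P T} (hσ : ¬ Unbalanced σ) : potential σ = 0 :=
  ((potential_eq_zero_or σ).resolve_right fun h0 => hσ h0.2).1

theorem six_le_potential {σ : State P T} (hσ : Unbalanced σ) : 6 ≤ potential σ :=
  ((potential_eq_zero_or σ).resolve_left fun h0 => by
    obtain ⟨i, hi⟩ := hσ
    have := h0.2 i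
    omega).1

/-- While no queue holds more than one task, every queued task is being executed. -/
theorem rem_add_balancedSlots_le (hp : ∀ j, 0 < p j) (h : List (Draw P)) (i : P) (j : T)
    (hj : j ∈ (stateAfter p place π h).queue i) :
    (stateAfter p place π h).rem j + balancedSlots p place π h ≤ Finset.univ.sup p := by
  induction h generalizing i with
  | nil => exact Finset.le_sup (f := p) (Finset.mem_univ j)
  | cons d h ih =>
    obtain ⟨k, hk⟩ := exists_mem_queue_of_step hj
    have hle := ih k hk
    have hv := valid_stateAfter (place := place) (π := π) hp h
    simp only [balancedSlots]
    change remAfter π h (stateAfter p place π h) j + _ ≤ _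
    split_ifs with hu
    · have := remAfter_le (π := π) (h := h) (σ := stateAfter p place π h) j
      omega
    · obtain ⟨j', hj'⟩ := exists_running (π := π) (h := h) k ⟨j, hk⟩
      have hone : ((stateAfter p place π h).queue k).card ≤ 1 := by
        by_contra hc
        exact hu ⟨k, by omega⟩
      -- The queue of `k` is a singleton, so `j` itself runs and loses the unit that the new
      -- balanced slot adds.
      obtain rfl := Finset.card_le_one.1 hone j hk j' (running_mem hv hj')
      have hpos := hv.rem_pos k j hk
      rw [remAfter, if_pos ⟨k, hj'⟩]
      omega

theorem balancedSlots_le (hp : ∀ j, 0 < p j) (ω : ℕ → Draw P) (t : ℕ)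
    (ht : ∀ s < t, ¬ Finished p place π ω s) :
    balancedSlots p place π (history ω t) ≤ Finset.univ.sup p := by
  cases t with
  | zero => exact Nat.zero_le _
  | succ t =>
    have hnf := ht t t.lt_succ_self
    simp only [Finished, not_forall] at hnf
    obtain ⟨i, hi⟩ := hnf
    obtain ⟨j, hj⟩ := Finset.nonempty_iff_ne_empty.2 hi
    have h1 := rem_add_balancedSlots_le hp _ i j hj
    have h2 := (valid_stateAfter hp (history ω t)).rem_pos i j hj
    simp only [history, balancedSlots]
    split_ifs <;> omega

theorem card_idle_lt {ω : ℕ → Draw P} {t : ℕ} (ht : ¬ Finished p place π ω t) :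
    (idle (stateAfter p place π (history ω t))).card < Fintype.card P := by
  simp only [Finished, not_forall] at ht
  obtain ⟨i, hi⟩ := ht
  exact Finset.card_lt_univ_of_notMem fun h0 => hi (mem_idle.1 h0)

/-- Before the makespan, every processor either works or is idle. -/
theorem work_balance (hp : ∀ j, 0 < p j) (ω : ℕ → Draw P) (t : ℕ)
    (ht : ∀ s < t, ¬ Finished p place π ω s) :
    Fintype.card P * t + ∑ j, (stateAfter p place π (history ω t)).rem j ≤
      ∑ j, p j + idleUnbalanced p place π (history ω t)
        + (Fintype.card P - 1) * balancedSlots p place π (history ω t) := by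
  induction t with
  | zero => simp [history, stateAfter, idleUnbalanced, balancedSlots]
  | succ t ih =>
    have ih := ih fun s hs => ht s (by omega)
    have hwork : ∑ j, (stateAfter p place π (history ω (t + 1))).rem j + Fintype.card P = _ :=
      sum_remAfter (π := π) (h := history ω t) (valid_stateAfter (place := place) hp (history ω t))
    have hlt := card_idle_lt (ht t t.lt_succ_self)
    simp only [history, idleUnbalanced, balancedSlots] at hwork ⊢
    split_ifs
    · rw [mul_add, mul_one, add_zero]
      omega
    · rw [mul_add, mul_add, mul_one, mul_one]
      omega

theorem sum_rem_add_le (hp : ∀ j, 0 < p j) (ω : ℕ → Draw P) (t : ℕ)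
    (ht : ∀ s < t, ¬ Finished p place π ω s) :
    ∑ j, (stateAfter p place π (history ω t)).rem j + t ≤ ∑ j, p j := by
  induction t with
  | zero => simp [history, stateAfter]
  | succ t ih =>
    have ih := ih fun s hs => ht s (by omega)
    have hwork : ∑ j, (stateAfter p place π (history ω (t + 1))).rem j + Fintype.card P = _ :=
      sum_remAfter (π := π) (h := history ω t) (valid_stateAfter (place := place) hp (history ω t))
    have hlt := card_idle_lt (ht t t.lt_succ_self)
    omega

theorem exists_finished (hp : ∀ j, 0 < p j) (ω : ℕ → Draw P) :
    ∃ t, Finished p place π ω t := by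
  by_contra! hc
  have := sum_rem_add_le hp ω (∑ j, p j + 1) fun s _ => hc s
  omega

theorem not_finished_of_lt {ω : ℕ → Draw P} {t : ℕ} (ht : t < makespan p place π ω) :
    ¬ Finished p place π ω t := Nat.notMem_of_lt_sInf ht

theorem makespan_le (hp : ∀ j, 0 < p j) (ω : ℕ → Draw P) :
    makespan p place π ω ≤ ∑ j, p j :=
  le_of_add_le_right (sum_rem_add_le hp ω _ fun _ hs => not_finished_of_lt hs)

theorem idleUnbalanced_mono (ω : ℕ → Draw P) :
    Monotone fun t => idleUnbalanced p place π (history ω t) :=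
  monotone_nat_of_le_succ fun _ => Nat.le_add_right _ _

/-- The idle count is taken at the deterministic time `∑ j, p j`, which the makespan never exceeds,
so no optional stopping is needed. -/
theorem card_mul_makespan_le (hp : ∀ j, 0 < p j) (ω : ℕ → Draw P) :
    Fintype.card P * makespan p place π ω ≤
      ∑ j, p j + idleUnbalanced p place π (history ω (∑ j, p j))
        + (Fintype.card P - 1) * Finset.univ.sup p := by
  have h1 := work_balance hp ω (makespan p place π ω) fun _ hs => not_finished_of_lt hs
  have h2 := Nat.mul_le_mul_left (Fintype.card P - 1)
    (balancedSlots_le hp ω (makespan p place π ω) fun _ hs => not_finished_of_lt hs)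
  have h3 := idleUnbalanced_mono (p := p) (place := place) (π := π) ω
    (makespan_le (place := place) (π := π) hp ω)
  dsimp only at h3
  omega

/-! ### Mean idle time in unbalanced slots -/

variable [Nontrivial P]

/-- The supermartingale behind the bound on the number of steal requests. -/
noncomputable def lyapunov (p : T → ℕ) (place : T → P) (π : Policy P T) (h : List (Draw P)) : ℝ :=
  idleUnbalanced p place π h
    + Fintype.card P * (1.08 / Real.log 2) * gauge (potential (stateAfter p place π h))

theorem sum_lyapunov_le (hp : ∀ j, 0 < p j) (h : List (Draw P)) :
    ∑ d, lyapunov p place π (d :: h) ≤ Fintype.card (Draw P) * lyapunov p place π h := by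
  have hv := valid_stateAfter (place := place) (π := π) hp h
  have hm := two_le_card P
  have hlog : 0 < Real.log 2 := Real.log_pos (by norm_num)
  have hK : (0 : ℝ) < Fintype.card P * (1.08 / Real.log 2) := by positivity
  have hsum := sum_potential_step_le (π := π) (h := h) hv
  have hD : (0 : ℝ) < Fintype.card (Draw P) := by exact_mod_cast Fintype.card_pos
  have key : ∑ d, gauge (potential (stateAfter p place π (d :: h))) ≤ Fintype.card (Draw P) *
      (gauge (potential (stateAfter p place π h)) -
        (if Unbalanced (stateAfter p place π h) then
          ((idle (stateAfter p place π h)).card : ℝ) else 0) /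
          (Fintype.card P * (1.08 / Real.log 2))) := by
    split_ifs with hu
    · have hr : (idle (stateAfter p place π h)).card ≤ Fintype.card P - 1 := by
        obtain ⟨i, hi⟩ := hu
        have : i ∉ idle (stateAfter p place π h) := fun h0 => by
          rw [mem_idle.1 h0] at hi
          simp at hi
        have := Finset.card_lt_univ_of_notMem this
        omega
      refine avg_gauge_le (fun d => potential_nonneg _) (six_le_potential hu) ?_
        (contraction_le hm hr) hsum
      have hm' : (2 : ℝ) ≤ Fintype.card P := by exact_mod_cast hm
      have : 0 ≤ 1 - 1 / ((Fintype.card P : ℝ) - 1) := by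
        rw [sub_nonneg, div_le_one (by linarith)]
        linarith
      have := pow_nonneg this (idle (stateAfter p place π h)).card
      linarith
    · have h0 := potential_of_not_unbalanced hu
      rw [h0, mul_zero, mul_zero] at hsum
      -- A nonnegative potential whose sum over the draws is at most zero vanishes for every draw:
      -- balance persists.
      have hz : ∀ d, potential (stateAfter p place π (d :: h)) = 0 := fun d =>
        le_antisymm ((Finset.single_le_sum (f := fun d => potential (stateAfter p place π (d :: h)))
          (fun d _ => potential_nonneg _) (Finset.mem_univ d)).trans hsum) (potential_nonneg _)
      simp [hz, h0, gauge]
  have key' := mul_le_mul_of_nonneg_left key hK.le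
  simp only [lyapunov, idleUnbalanced]
  rw [Finset.sum_add_distrib, ← Finset.mul_sum, Finset.sum_const, Finset.card_univ, nsmul_eq_mul]
  refine (add_le_add_right key' _).trans (le_of_eq ?_)
  push_cast
  field_simp
  ring

/-- The gauge term is dropped at time `t`; it is nonnegative because a potential is either `0` or at
least `6`. -/
theorem integral_idleUnbalanced_le (hp : ∀ j, 0 < p j) (t : ℕ) :
    ∫ ω, (idleUnbalanced p place π (history ω t) : ℝ) ∂law P ≤
      Fintype.card P * (1.08 / Real.log 2) * gauge (potential (stateAfter p place π [])) := by
  have hlog : 0 < Real.log 2 := Real.log_pos (by norm_num)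
  have h1 := integral_history_le (lyapunov p place π) (sum_lyapunov_le hp) t
  refine (integral_mono (integrable_history t fun h => (idleUnbalanced p place π h : ℝ))
    (integrable_history t (lyapunov p place π)) fun ω => ?_).trans (h1.trans (le_of_eq ?_))
  · refine le_add_of_nonneg_right (mul_nonneg (by positivity) (gauge_nonneg ?_))
    rcases potential_eq_zero_or (stateAfter p place π (history ω t)) with h0 | h0
    · exact Or.inl h0.1
    · exact Or.inr (by linarith [h0.1])
  · simp [lyapunov, idleUnbalanced]

theorem potential_init_le :
    potential (stateAfter p place π []) ≤ (Fintype.card T : ℝ) ^ 3 := by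
  refine (pot_sum_le _ _).trans ((pot_le_cube _).trans (le_of_eq ?_))
  congr 2
  exact (Finset.card_eq_sum_card_fiberwise fun j _ => Finset.mem_univ (place j)).symm

theorem gauge_potential_init_le [Nonempty T] :
    gauge (potential (stateAfter p place π [])) ≤ 3 * Real.log (Fintype.card T) + 1 := by
  have hn : (1 : ℝ) ≤ Fintype.card T := by exact_mod_cast Fintype.card_pos (α := T)
  unfold gauge
  split_ifs with h0
  · have := Real.log_nonneg hn
    linarith
  · have hpos := lt_of_le_of_ne (potential_nonneg _) (Ne.symm h0)
    have := Real.log_le_log hpos potential_init_le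
    rw [Real.log_pow] at this
    push_cast at this
    linarith

/-! ### Measurability and integrability of the makespan -/

theorem measurable_makespan (hp : ∀ j, 0 < p j) :
    Measurable fun ω : ℕ → Draw P => makespan p place π ω := by
  refine measurable_of_Iic fun t => ?_
  have : (fun ω : ℕ → Draw P => makespan p place π ω) ⁻¹' Set.Iic t =
      ⋃ s ∈ Set.Iic t, {ω | Finished p place π ω s} := by
    ext ω
    simp only [Set.mem_preimage, Set.mem_Iic, Set.mem_iUnion, exists_prop, Set.mem_ofPred_eq]
    exact ⟨fun hle => ⟨_, hle, Nat.sInf_mem (exists_finished hp ω)⟩,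
      fun ⟨s, hs, hf⟩ => (Nat.sInf_le hf).trans hs⟩
  rw [this]
  exact MeasurableSet.biUnion (Set.to_countable _) fun s _ => measurableSet_setOfPred.2 <|
    measurable_history s fun h => ∀ i, (stateAfter p place π h).queue i = ∅

theorem integrable_makespan (hp : ∀ j, 0 < p j) :
    Integrable (fun ω => (makespan p place π ω : ℝ)) (law P) :=
  Integrable.of_bound ((measurable_from_nat (f := fun n : ℕ => (n : ℝ))).comp
    (measurable_makespan hp)).aestronglyMeasurable ((∑ j, p j : ℕ) : ℝ)
    (Filter.Eventually.of_forall fun ω => by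
      rw [Real.norm_natCast]
      exact_mod_cast makespan_le hp ω)

end Makespan

end DLS

/-! ### Taking expectations -/

theorem theorem4 {P T : Type*} [Fintype P] [DecidableEq P] [Nontrivial P]
    [Fintype T] [DecidableEq T] [Nonempty T]
    (p : T → ℕ) (hp : ∀ j, 0 < p j) (place : T → P) (π : DLS.Policy P T) :
    (∀ ω, ∃ t, DLS.Finished p place π ω t) ∧
    MeasureTheory.Integrable (fun ω => (DLS.makespan p place π ω : ℝ)) (DLS.law P) ∧
    ∫ ω, (DLS.makespan p place π ω : ℝ) ∂(DLS.law P) ≤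
      (∑ j, (p j : ℝ)) / (Fintype.card P : ℝ)
        + ((Fintype.card P : ℝ) - 1) / (Fintype.card P : ℝ) * ((Finset.univ.sup p : ℕ) : ℝ)
        + 3.24 * (Real.logb 2 (Fintype.card T : ℝ) + 1 / (2 * Real.log 2)) + 1 := by
  refine ⟨DLS.exists_finished hp, DLS.integrable_makespan hp, ?_⟩
  have hm := DLS.two_le_card P
  have hm0 : (0 : ℝ) < Fintype.card P := by exact_mod_cast (by omega : 0 < Fintype.card P)
  have hlog : 0 < Real.log 2 := Real.log_pos (by norm_num)
  have hI := DLS.integrable_history (P := P) (∑ j, p j)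
    fun h => (DLS.idleUnbalanced p place π h : ℝ)
  have hpath : ∀ ω, (Fintype.card P : ℝ) * DLS.makespan p place π ω ≤
      (∑ j, (p j : ℝ) + ((Fintype.card P : ℝ) - 1) * ((Finset.univ.sup p : ℕ) : ℝ)) +
        DLS.idleUnbalanced p place π (DLS.history ω (∑ j, p j)) := fun ω => by
    have h1 : ((Fintype.card P * DLS.makespan p place π ω : ℕ) : ℝ) ≤ _ :=
      Nat.cast_le.2 (DLS.card_mul_makespan_le (place := place) (π := π) hp ω)
    push_cast [Nat.cast_sub (by omega : 1 ≤ Fintype.card P)] at h1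
    linarith
  have hmean := MeasureTheory.integral_mono
    ((DLS.integrable_makespan (place := place) (π := π) hp).const_mul
    (Fintype.card P : ℝ)) ((MeasureTheory.integrable_const _).add hI) hpath
  rw [MeasureTheory.integral_const_mul, MeasureTheory.integral_add' (MeasureTheory.integrable_const _) hI, MeasureTheory.integral_const] at hmean
  simp only [MeasureTheory.probReal_univ, one_smul] at hmean
  have hidle := (DLS.integral_idleUnbalanced_le (place := place) (π := π) hp (∑ j, p j)).trans
    (mul_le_mul_of_nonneg_left DLS.gauge_potential_init_le (by positivity))
  have htot := hmean.trans (add_le_add_right hidle _)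
  rw [← le_div_iff₀' hm0] at htot
  refine htot.trans ?_
  have e : (∑ j, (p j : ℝ) + ((Fintype.card P : ℝ) - 1) * ((Finset.univ.sup p : ℕ) : ℝ) +
      Fintype.card P * (1.08 / Real.log 2) * (3 * Real.log (Fintype.card T) + 1)) /
        Fintype.card P = (∑ j, (p j : ℝ)) / (Fintype.card P : ℝ)
        + ((Fintype.card P : ℝ) - 1) / (Fintype.card P : ℝ) * ((Finset.univ.sup p : ℕ) : ℝ)
        + (3.24 * (Real.log (Fintype.card T) / Real.log 2) + 1.08 / Real.log 2) := by
    field_simp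
    ring
  rw [e, Real.logb, mul_add, show (3.24 : ℝ) * (1 / (2 * Real.log 2)) = 1.62 / Real.log 2 by
    field_simp; norm_num]
  -- The argument yields 1.08 where the statement allows `3.24 / 2 = 1.62`; the final `+ 1` is slack
  -- as well.
  have : 1.08 / Real.log 2 ≤ 1.62 / Real.log 2 := by gcongr; norm_num
  linarith
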